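/- Let $A\in\mathbb{Z}^{m\times n}$ be an integral matrix whose rows $a^{(1)},\ldots,a^{(m)}$ are linearly independent, and let $b\in\mathbb{Z}^m$. Let $\mathcal{P}=\{x\in\mathbb{R}^n \mid Ax=b,\ x\ge 0\}$ and let $\mathcal{P}_I=\operatorname{Conv}(\mathcal{P}\cap\mathbb{Z}^n)$ be its integer hull. A point $v\in\mathcal{P}_I$ is called a vertex of $\mathcal{P}_I$ if $v\notin\operatorname{Conv}(\mathcal{P}_I\setminus\{v\})$, and $\operatorname{supp}(v)=\{i \mid v_i\neq 0\}$. Then every vertex $v$ of $\mathcal{P}_I$ satisfies $$|\operatorname{supp}(v)|\le m+m\log_2(m)+\log_2\bigl(\sqrt{\det(AA^{\top})}\bigr),$$ where $0\cdot\log_2(0)$ is read as $0$ in the degenerate case $m=0$. -/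

import Mathlib

/-- The polyhedron `{x ∈ ℝⁿ | A x = b, x ≥ 0}` given by an integral constraint matrix `A` and an
integral right-hand side `b`. -/
def polytope {m n : ℕ} (A : Matrix (Fin m) (Fin n) ℤ) (b : Fin m → ℤ) : Set (Fin n → ℝ) :=
  {x | (A.map (Int.cast : ℤ → ℝ)).mulVec x = (fun i => (b i : ℝ)) ∧ ∀ j, 0 ≤ x j}

/-- The points of `ℝⁿ` all of whose coordinates are integers. -/
def integerPoints (n : ℕ) : Set (Fin n → ℝ) :=
  {x | ∀ j, ∃ z : ℤ, x j = (z : ℝ)}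

/-- The convex hull of all integral points of the polyhedron `{x | A x = b, x ≥ 0}`. -/
def integerHull {m n : ℕ} (A : Matrix (Fin m) (Fin n) ℤ) (b : Fin m → ℤ) : Set (Fin n → ℝ) :=
  convexHull ℝ (polytope A b ∩ integerPoints n)

/-- `v` is a vertex of `K` if it lies in `K` and is not a convex combination of other points
of `K`. -/
def IsVertexOf {n : ℕ} (v : Fin n → ℝ) (K : Set (Fin n → ℝ)) : Prop :=
  v ∈ K ∧ v ∉ convexHull ℝ (K \ {v})

/-- The set of indices of the non-zero coordinates of `x`. -/
noncomputable def supp {n : ℕ} (x : Fin n → ℝ) : Finset (Fin n) :=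
  Finset.univ.filter (fun j => x j ≠ 0)

/-! Let S be the support of v. If z ≠ 0 lies in the kernel of A, has entries in {-1, 0, 1} and is
supported on S, then v + z and v - z are integral points of the polyhedron with midpoint v, so v is
not a vertex. It remains to deduce 2^|S| ≤ (2m)^m √det(AAᵀ) from the absence of such z
(`two_pow_card_le`) and to take logarithms.

For m ≥ 2, take a large prime q and a box of 2^|S| q^n grid points, with sides 2q on S and q off S.
Points of one fibre of A that agree mod q differ by q z with z as above, hence coincide; so each
fibre has at most q^(n-m) points (`card_fiber_box_mul_le`). Conversely, after the rows of A are
orthogonalised, Chebyshev's inequality sends most of the box into a skewed box with about (3mq/2)^m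
√det(AAᵀ) lattice points. Comparing the counts and letting q → ∞ gives the bound.

For m = 1 these constants are too weak; there the 2^|S| subset sums are distinct integers, and their
variance suffices. -/

/-! ### Vertices of the integer hull -/

theorem IsVertexOf.mem_of_convexHull {n : ℕ} {v : Fin n → ℝ} {X : Set (Fin n → ℝ)}
    (hv : IsVertexOf v (convexHull ℝ X)) : v ∈ X := by
  by_contra h
  have hsub : X ⊆ convexHull ℝ X \ {v} := fun x hx =>
    ⟨subset_convexHull ℝ X hx, fun e => h (Set.mem_singleton_iff.1 e ▸ hx)⟩
  exact hv.2 (convexHull_mono hsub hv.1)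

/-- A vertex of the integer hull admits no nonzero integral kernel direction with entries in
`{-1, 0, 1}` supported on the support of the vertex. -/
theorem eq_zero_of_isVertexOf_integerHull {m n : ℕ} {A : Matrix (Fin m) (Fin n) ℤ}
    {b : Fin m → ℤ} {v : Fin n → ℝ} (hv : IsVertexOf v (integerHull A b)) (z : Fin n → ℤ)
    (hz : ∀ j, |z j| ≤ 1) (hzS : ∀ j, j ∉ supp v → z j = 0) (hAz : A.mulVec z = 0) : z = 0 := by
  by_contra hne
  obtain ⟨⟨hAv, hpos⟩, hint⟩ := IsVertexOf.mem_of_convexHull hv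
  have hAz' : (A.map (Int.cast : ℤ → ℝ)).mulVec (fun j => (z j : ℝ)) = 0 := by
    funext i
    have := congrFun hAz i
    simp only [Matrix.mulVec, dotProduct, Matrix.map_apply, Pi.zero_apply] at this ⊢
    exact_mod_cast this
  have hone : ∀ j, j ∈ supp v → 1 ≤ v j := by
    intro j hj
    obtain ⟨k, hk⟩ := hint j
    have h0 : v j ≠ 0 := by simpa [supp] using hj
    have h1 := lt_of_le_of_ne (hpos j) h0.symm
    rw [hk] at h1 ⊢
    exact_mod_cast h1
  -- Nonnegativity survives the move by ±z because v is at least 1 on its support.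
  have key : ∀ c : ℤ, |c| = 1 →
      (v + (c : ℝ) • (fun j => (z j : ℝ))) ∈ integerHull A b \ {v} := by
    intro c hc
    refine ⟨subset_convexHull ℝ _ ⟨⟨?_, ?_⟩, ?_⟩, ?_⟩
    · rw [Matrix.mulVec_add, Matrix.mulVec_smul, hAz', smul_zero, add_zero, hAv]
    · intro j
      by_cases hj : j ∈ supp v
      · have h1 : |c * z j| ≤ 1 := by rw [abs_mul, hc, one_mul]; exact hz j
        have h2 : (-1 : ℝ) ≤ c * z j := by exact_mod_cast (abs_le.1 h1).1
        simp only [Pi.add_apply, Pi.smul_apply, smul_eq_mul]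
        linarith [hone j hj]
      · simp [hzS j hj, hpos j]
    · intro j
      obtain ⟨k, hk⟩ := hint j
      exact ⟨k + c * z j, by simp [hk]⟩
    · intro h
      apply hne
      funext j
      have h1 := congrFun (show _ = v from h) j
      have hc0 : c ≠ 0 := by rintro rfl; simp at hc
      simpa [hc0] using h1
  apply hv.2
  have h1 := subset_convexHull ℝ _ (key 1 (by simp))
  have h2 := subset_convexHull ℝ _ (key (-1) (by simp))
  have h3 := convex_convexHull ℝ (integerHull A b \ {v}) h1 h2
    (a := 1 / 2) (b := 1 / 2) (by norm_num) (by norm_num) (by norm_num)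
  convert h3 using 1
  funext j
  simp
  ring

/-! ### Second moments of integer sets and of boxes -/

/-- Equality holds for consecutive integers centred at c. The induction removes the minimum and the
maximum. -/
theorem Finset.le_sum_sub_sq (Y : Finset ℤ) (c : ℝ) :
    (Y.card : ℝ) * ((Y.card : ℝ) ^ 2 - 1) / 12 ≤ ∑ y ∈ Y, ((y : ℝ) - c) ^ 2 := by
  induction h : Y.card using Nat.strong_induction_on generalizing Y with
  | _ N ih =>
    subst h
    by_cases hN : Y.card ≤ 1
    · have : (Y.card : ℝ) * ((Y.card : ℝ) ^ 2 - 1) / 12 = 0 := by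
        interval_cases Y.card <;> norm_num
      rw [this]
      positivity
    push Not at hN
    obtain ⟨a, ha, b, hb, hab⟩ := Finset.one_lt_card.1 hN
    have hne : Y.Nonempty := ⟨a, ha⟩
    set p := Y.min' hne
    set r := Y.max' hne
    have hpr : p < r := Finset.min'_lt_max' Y ha hb hab
    have hp : p ∈ Y := Y.min'_mem hne
    have hr : r ∈ Y.erase p := Finset.mem_erase.2 ⟨hpr.ne', Y.max'_mem hne⟩
    have hc1 : (Y.erase p).card + 1 = Y.card := Finset.card_erase_add_one hp
    have hc2 : ((Y.erase p).erase r).card + 1 = (Y.erase p).card := Finset.card_erase_add_one hr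
    have h1 := ih _ (by omega) ((Y.erase p).erase r) rfl
    rw [← Finset.add_sum_erase _ _ hp, ← Finset.add_sum_erase _ _ hr]
    have hsub : Y ⊆ Finset.Icc p r := fun y hy =>
      Finset.mem_Icc.2 ⟨Y.min'_le y hy, Y.le_max' y hy⟩
    have hcard := Finset.card_le_card hsub
    rw [Int.card_Icc] at hcard
    have hle : (Y.card : ℝ) - 1 ≤ r - p := by
      have : (Y.card : ℤ) - 1 ≤ r - p := by omega
      exact_mod_cast this
    have hc3 : (((Y.erase p).erase r).card : ℝ) = Y.card - 2 := by
      have : ((Y.erase p).erase r).card + 2 = Y.card := by omega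
      rw [← this]; push_cast; ring
    rw [hc3] at h1
    have h2 : (1 : ℝ) < Y.card := by exact_mod_cast hN
    -- The two extremes contribute at least (r - p)²/2 ≥ (N - 1)²/2, exactly the increment of N(N² -
    -- 1)/12 from N - 2 to N.
    nlinarith [sq_nonneg ((p : ℝ) + r - 2 * c), mul_self_le_mul_self (by linarith) hle]

/-- Distinct coordinates of a product set are independent, so the cross terms of a centred linear
form vanish. -/
theorem Fintype.sum_piFinset_mul_eq_zero {ι α : Type*} [Fintype ι] [DecidableEq ι]
    (T : ι → Finset α) (f : ι → α → ℝ) {i j : ι} (hij : i ≠ j) (hf : ∑ a ∈ T i, f i a = 0) :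
    ∑ u ∈ Fintype.piFinset T, f i (u i) * f j (u j) = 0 := by
  have h := Finset.prod_univ_sum T
    (fun k a => if k = i then f i a else if k = j then f j a else 1)
  rw [Finset.prod_eq_zero (Finset.mem_univ i) (by simpa using hf)] at h
  rw [h]
  refine Finset.sum_congr rfl fun u _ => ?_
  rw [← Finset.mul_prod_erase _ _ (Finset.mem_univ i),
    ← Finset.mul_prod_erase _ _ (Finset.mem_erase.2 ⟨hij.symm, Finset.mem_univ j⟩),
    Finset.prod_eq_one]
  · simp [hij.symm]
  · intro k hk
    simp only [Finset.mem_erase] at hk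
    simp [hk.1, hk.2.1]

theorem Fintype.sum_piFinset_eval {ι α : Type*} [Fintype ι] [DecidableEq ι]
    (T : ι → Finset α) (i : ι) (g : α → ℝ) (s : ℝ) (hg : ∑ a ∈ T i, g a = (T i).card * s) :
    ∑ u ∈ Fintype.piFinset T, g (u i) = (Fintype.piFinset T).card * s := by
  have h := Finset.prod_univ_sum T (fun k a => if k = i then g a else 1)
  have h1 : ∀ u : ι → α, (∏ k, if k = i then g (u k) else 1) = g (u i) := by
    intro u; simp
  simp only [h1] at h
  rw [← h, Fintype.card_piFinset, Nat.cast_prod,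
    ← Finset.mul_prod_erase _ _ (Finset.mem_univ i),
    ← Finset.mul_prod_erase (Finset.univ) (fun k => ((T k).card : ℝ)) (Finset.mem_univ i)]
  have h2 : ∏ k ∈ Finset.univ.erase i, ∑ a ∈ T k, (if k = i then g a else (1 : ℝ))
      = ∏ k ∈ Finset.univ.erase i, ((T k).card : ℝ) := by
    refine Finset.prod_congr rfl fun k hk => ?_
    simp [(Finset.mem_erase.1 hk).1]
  rw [h2]
  simp only [if_true, hg]
  ring

theorem sum_range_centered (N : ℕ) : ∑ k ∈ Finset.range N, ((k : ℝ) - (N - 1) / 2) = 0 := by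
  have h : ∀ M : ℕ, ∑ k ∈ Finset.range M, (k : ℝ) = M * (M - 1) / 2 := by
    intro M
    induction M with
    | zero => simp
    | succ M ih => rw [Finset.sum_range_succ, ih]; push_cast; ring
  rw [Finset.sum_sub_distrib, h]
  simp
  ring

theorem sum_range_centered_sq (N : ℕ) :
    ∑ k ∈ Finset.range N, ((k : ℝ) - (N - 1) / 2) ^ 2 = N * (((N : ℝ) ^ 2 - 1) / 12) := by
  have h : ∀ (M : ℕ) (c : ℝ), ∑ k ∈ Finset.range M, ((k : ℝ) - c) ^ 2
      = M * (M - 1) * (2 * M - 1) / 6 - c * M * (M - 1) + M * c ^ 2 := by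
    intro M c
    induction M with
    | zero => simp
    | succ M ih => rw [Finset.sum_range_succ, ih]; push_cast; ring
  rw [h]
  ring

/-- The second moment of a linear form over the grid points of a box. -/
theorem sum_piFinset_range_sq {ι : Type*} [Fintype ι] [DecidableEq ι] (N : ι → ℕ) (e : ι → ℝ) :
    ∑ u ∈ Fintype.piFinset (fun j => Finset.range (N j)),
        (∑ j, e j * ((u j : ℝ) - (N j - 1) / 2)) ^ 2
      = (Fintype.piFinset (fun j => Finset.range (N j))).card
        * ∑ j, e j ^ 2 * (((N j : ℝ) ^ 2 - 1) / 12) := by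
  simp only [sq (∑ j, _), Finset.sum_mul_sum]
  rw [Finset.sum_comm, Finset.mul_sum]
  refine Finset.sum_congr rfl fun i _ => ?_
  rw [Finset.sum_comm, Finset.sum_eq_single i]
  · refine Fintype.sum_piFinset_eval (fun j => Finset.range (N j)) i
      (fun a => e i * ((a : ℝ) - (N i - 1) / 2) * (e i * ((a : ℝ) - (N i - 1) / 2))) _ ?_
    have h := sum_range_centered_sq (N i)
    rw [Finset.card_range]
    calc _ = e i ^ 2 * ∑ k ∈ Finset.range (N i), ((k : ℝ) - (N i - 1) / 2) ^ 2 := by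
          rw [Finset.mul_sum]; exact Finset.sum_congr rfl fun k _ => by ring
      _ = _ := by rw [h]; ring
  · intro j _ hji
    refine Fintype.sum_piFinset_mul_eq_zero (fun j => Finset.range (N j))
      (fun k a => e k * ((a : ℝ) - (N k - 1) / 2)) hji.symm ?_
    rw [← Finset.mul_sum, sum_range_centered, mul_zero]
  · simp

/-! ### Lattice points in a skewed box -/

/-- Lattice points in a box that is skewed by a unit lower triangular matrix. -/
theorem card_le_of_lowerTriangular {m : ℕ} (L : Matrix (Fin m) (Fin m) ℝ)
    (hL : ∀ i j, i < j → L i j = 0) (hL1 : ∀ i, L i i = 1) (c r : Fin m → ℝ) (hr : ∀ i, 0 ≤ r i)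
    (Y : Finset (Fin m → ℤ))
    (hY : ∀ y ∈ Y, ∀ i, |L.mulVec (fun k => (y k : ℝ)) i - c i| ≤ r i) :
    (Y.card : ℝ) ≤ ∏ i, (2 * r i + 3) := by
  have hsplit : ∀ (y : Fin m → ℤ) i, L.mulVec (fun k => (y k : ℝ)) i
      = y i + ∑ k ∈ Finset.univ.filter (· < i), L i k * y k := by
    intro y i
    rw [Matrix.mulVec, dotProduct, ← Finset.add_sum_erase _ _ (Finset.mem_univ i), hL1, one_mul]
    congr 1
    symm
    refine Finset.sum_subset ?_ ?_
    · intro k hk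
      simp only [Finset.mem_filter] at hk
      simp [hk.2.ne]
    · intro k hk hk'
      simp only [Finset.mem_erase, Finset.mem_univ, and_true, Finset.mem_filter, true_and,
        not_lt] at hk hk'
      rw [hL i k (lt_of_le_of_ne hk' (Ne.symm hk)), zero_mul]
  -- Each coordinate is shifted by an integer depending only on earlier ones; this straightens the
  -- skewed box and is undone coordinate by coordinate.
  set F : (Fin m → ℤ) → (Fin m → ℤ) := fun y i =>
    y i + ⌊(∑ k ∈ Finset.univ.filter (· < i), L i k * y k) - c i⌋ with hF
  have hinj : Function.Injective F := by
    intro y y' h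
    funext i
    induction i using WellFoundedLT.induction with
    | _ i ih =>
      have h1 := congrFun h i
      simp only [hF] at h1
      rw [Finset.sum_congr rfl (g := fun k => L i k * (y' k : ℝ))
        (fun k hk => by rw [ih k (Finset.mem_filter.1 hk).2])] at h1
      exact add_right_cancel h1
  have hmaps : ∀ y ∈ Y, F y ∈
      Fintype.piFinset (fun i => Finset.Icc (⌊-r i⌋ - 1) ⌊r i⌋) := by
    intro y hy
    rw [Fintype.mem_piFinset]
    intro i
    have h := abs_le.1 (hY y hy i)
    rw [hsplit, add_sub_assoc] at h
    simp only [hF, Finset.mem_Icc]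
    have h1 := Int.floor_le ((∑ k ∈ Finset.univ.filter (· < i), L i k * (y k : ℝ)) - c i)
    have h2 := Int.lt_floor_add_one
      ((∑ k ∈ Finset.univ.filter (· < i), L i k * (y k : ℝ)) - c i)
    constructor
    · have : ⌊-r i⌋ ≤ ⌊(y i : ℝ) + ((∑ k ∈ Finset.univ.filter (· < i), L i k * (y k : ℝ)) - c i)⌋ :=
        Int.floor_le_floor h.1
      rw [Int.floor_intCast_add] at this
      omega
    · rw [Int.le_floor]
      push_cast
      linarith
  have hcard := Finset.card_le_card_of_injOn F hmaps hinj.injOn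
  rw [Fintype.card_piFinset] at hcard
  calc (Y.card : ℝ) ≤ ((∏ i, (Finset.Icc (⌊-r i⌋ - 1) ⌊r i⌋).card : ℕ) : ℝ) := by
        exact_mod_cast hcard
    _ ≤ _ := by
        rw [Nat.cast_prod]
        refine Finset.prod_le_prod (fun i _ => by positivity) fun i _ => ?_
        rw [Int.card_Icc]
        have h1 := Int.floor_le (r i)
        have h2 := Int.lt_floor_add_one (-r i)
        have h3 : ⌊-r i⌋ ≤ ⌊r i⌋ := Int.floor_le_floor (by linarith [hr i])
        have h4 : (((⌊r i⌋ + 1 - (⌊-r i⌋ - 1)).toNat : ℤ) : ℝ)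
            = ((⌊r i⌋ + 1 - (⌊-r i⌋ - 1) : ℤ) : ℝ) := by
          rw [Int.toNat_of_nonneg (by omega)]
        rw [Int.cast_natCast] at h4
        rw [h4]
        push_cast
        linarith

/-! ### The Gram matrix and its orthogonalisation -/

open Matrix in
-- An LDL decomposition, with rows rescaled to a unit diagonal so that L has determinant 1 and ∏ dᵢ
-- keeps the determinant of G.
theorem Matrix.PosDef.exists_lowerTriangular_conj {m : ℕ} {G : Matrix (Fin m) (Fin m) ℝ}
    (hG : G.PosDef) : ∃ (L : Matrix (Fin m) (Fin m) ℝ) (d : Fin m → ℝ),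
      (∀ i j, i < j → L i j = 0) ∧ (∀ i, L i i = 1) ∧ L * G * Lᵀ = diagonal d ∧
      ∏ i, d i = G.det := by
  set L₀ := LDL.lowerInv hG
  have htri : ∀ i j, i < j → L₀ i j = 0 := fun i j h => LDL.lowerInv_triangular hG h
  have hdet : L₀.det ≠ 0 := (Matrix.isUnit_det_of_invertible L₀).ne_zero
  rw [Matrix.det_of_isLowerTriangular L₀ (fun i j h => htri i j h)] at hdet
  have hdiag : ∀ i, L₀ i i ≠ 0 := fun i => Finset.prod_ne_zero_iff.1 hdet i (Finset.mem_univ i)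
  set E : Matrix (Fin m) (Fin m) ℝ := diagonal fun i => (L₀ i i)⁻¹ with hE
  have hconj : L₀ * G * L₀ᵀ = diagonal (LDL.diagEntries hG) :=
    (LDL.diag_eq_lowerInv_conj hG).symm
  have htri' : ∀ i j, i < j → (E * L₀) i j = 0 := fun i j h => by
    simp [hE, Matrix.diagonal_mul, htri i j h]
  have hone : ∀ i, (E * L₀) i i = 1 := fun i => by
    simp [hE, Matrix.diagonal_mul, hdiag i]
  have hd : (E * L₀) * G * (E * L₀)ᵀ
      = diagonal fun i => (L₀ i i)⁻¹ * LDL.diagEntries hG i * (L₀ i i)⁻¹ := by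
    calc (E * L₀) * G * (E * L₀)ᵀ = E * (L₀ * G * L₀ᵀ) * Eᵀ := by
          simp only [Matrix.transpose_mul, Matrix.mul_assoc]
      _ = _ := by
          rw [hconj, hE, Matrix.diagonal_transpose, Matrix.diagonal_mul_diagonal,
            Matrix.diagonal_mul_diagonal]
  refine ⟨E * L₀, _, htri', hone, hd, ?_⟩
  have h1 : (E * L₀).det = 1 := by
    rw [Matrix.det_of_isLowerTriangular _ (fun i j h => htri' i j h)]
    simp [hone]
  rw [← Matrix.det_diagonal, ← hd, Matrix.det_mul, Matrix.det_mul, Matrix.det_transpose, h1]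
  ring

theorem Matrix.posDef_mul_transpose_of_linearIndependent_row {m n : ℕ}
    {B : Matrix (Fin m) (Fin n) ℝ} (hB : LinearIndependent ℝ B.row) :
    (B * B.transpose).PosDef := by
  have := Matrix.PosDef.mul_conjTranspose_self B (Matrix.vecMul_injective_iff.2 hB)
  simpa using this

/-! ### Fibres modulo a prime -/

/-- Invertibility of BBᵀ makes B surjective, and all fibres are translates of one another. -/
theorem Matrix.card_mulVec_fiber_mul {m n : ℕ} (q : ℕ) [Fact q.Prime]
    (B : Matrix (Fin m) (Fin n) (ZMod q)) (hB : (B * B.transpose).det ≠ 0) (y : Fin m → ZMod q) :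
    Nat.card {t // B.mulVec t = y} * q ^ m = q ^ n := by
  have hsurj : Function.Surjective B.mulVec := fun w => by
    refine ⟨B.transpose.mulVec ((B * B.transpose)⁻¹.mulVec w), ?_⟩
    rw [Matrix.mulVec_mulVec, Matrix.mulVec_mulVec, Matrix.mul_nonsing_inv _ hB.isUnit,
      Matrix.one_mulVec]
  have hfib : ∀ w, Nat.card {t // B.mulVec t = w} = Nat.card {t // B.mulVec t = y} := by
    intro w
    obtain ⟨s, hs⟩ := hsurj (w - y)
    refine Nat.card_congr ((Equiv.subRight s).subtypeEquiv fun t => ?_)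
    rw [Equiv.subRight_apply, Matrix.mulVec_sub, hs, sub_sub_eq_add_sub, sub_eq_iff_eq_add,
      add_comm y, add_left_inj]
  have h := Nat.card_congr (Equiv.sigmaFiberEquiv B.mulVec)
  rw [Nat.card_sigma] at h
  simp only [hfib] at h
  simpa [mul_comm] using h

/-- If `A` separates points differing by `{-1, 0, 1}` vectors supported on `S`, a fibre of `A` in
the box with sides `2 q` on `S` and `q` off `S` has at most `q ^ (n - m)` points. -/
theorem card_fiber_box_mul_le {m n : ℕ} (A : Matrix (Fin m) (Fin n) ℤ) (S : Finset (Fin n))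
    (hS : ∀ z : Fin n → ℤ, (∀ j, |z j| ≤ 1) → (∀ j, j ∉ S → z j = 0) → A.mulVec z = 0 → z = 0)
    (q : ℕ) (hq : q.Prime) (hdet : ¬ (q : ℤ) ∣ (A * A.transpose).det) (y : Fin m → ℤ) :
    ((Fintype.piFinset (fun j => Finset.range (if j ∈ S then 2 * q else q))).filter
      (fun u : Fin n → ℕ => A.mulVec (fun j => (u j : ℤ)) = y)).card * q ^ m ≤ q ^ n := by
  have := Fact.mk hq
  set B : Matrix (Fin m) (Fin n) (ZMod q) := A.map (Int.cast : ℤ → ZMod q) with hBdef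
  have hB : (B * B.transpose).det ≠ 0 := by
    have h1 : B * B.transpose = (Int.castRingHom (ZMod q)).mapMatrix (A * A.transpose) := by
      ext i j
      simp [hBdef, Matrix.mul_apply]
    rw [h1, ← RingHom.map_det, eq_intCast, Ne, ZMod.intCast_zmod_eq_zero_iff_dvd]
    exact hdet
  rw [← Matrix.card_mulVec_fiber_mul q B hB (fun i => (y i : ZMod q))]
  refine Nat.mul_le_mul_right _ ?_
  rw [Nat.card_eq_fintype_card, Fintype.card_subtype]
  refine Finset.card_le_card_of_injOn (fun u j => (u j : ZMod q)) ?_ ?_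
  · intro u hu
    simp only [Finset.coe_filter, Set.mem_ofPred_eq] at hu
    simp only [Finset.coe_filter, Set.mem_ofPred_eq, Finset.mem_univ, true_and]
    funext i
    rw [← hu.2]
    simp [hBdef, Matrix.mulVec, dotProduct]
  · intro u hu w hw huw
    simp only [Finset.coe_filter, Set.mem_ofPred_eq, Fintype.mem_piFinset,
      Finset.mem_range] at hu hw
    have hdvd : ∀ j, (q : ℤ) ∣ (u j : ℤ) - w j := fun j => by
      rw [← ZMod.intCast_zmod_eq_zero_iff_dvd]
      have := congrFun huw j
      push_cast
      exact sub_eq_zero.2 this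
    choose z hz using hdvd
    have hq0 : (0 : ℤ) < q := by exact_mod_cast hq.pos
    have hz0 : z = 0 := by
      -- The entries of q z are below 2q in absolute value, and below q off S.
      refine hS z (fun j => ?_) (fun j hj => ?_) ?_
      · have h1 := hu.1 j
        have h2 := hw.1 j
        have h3 := hz j
        have h4 : u j < 2 * q ∧ w j < 2 * q := by split_ifs at h1 h2 <;> omega
        rw [abs_le]
        constructor <;> by_contra hc <;> push Not at hc <;> zify at h4 <;> nlinarith
      · have h1 := hu.1 j
        have h2 := hw.1 j
        have h3 := hz j
        rw [if_neg hj] at h1 h2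
        zify at h1 h2
        by_contra hc
        rcases lt_or_gt_of_ne hc with hc | hc <;> nlinarith
      · have h1 : (q : ℤ) • A.mulVec z = 0 := by
          rw [← Matrix.mulVec_smul]
          have h2 : (q : ℤ) • z = (fun j => (u j : ℤ)) - fun j => (w j : ℤ) := by
            funext j
            simp [hz j]
          rw [h2, Matrix.mulVec_sub, hu.2, hw.2, sub_self]
        exact (smul_eq_zero.1 h1).resolve_left hq0.ne'
    funext j
    have := hz j
    simp [hz0] at this
    omega

/-! ### Chebyshev's inequality on the box -/

theorem card_filter_linearForm_mul_le {n : ℕ} (N : Fin n → ℕ) (q : ℕ) (hN : ∀ j, N j ≤ 2 * q)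
    (e : Fin n → ℝ) (he : 0 < ∑ j, e j ^ 2) (R : ℝ) (hR : 0 ≤ R) :
    (((Fintype.piFinset fun j => Finset.range (N j)).filter fun u =>
        R * √(∑ j, e j ^ 2) < |∑ j, e j * ((u j : ℝ) - (N j - 1) / 2)|).card : ℝ) * R ^ 2
      ≤ (Fintype.piFinset fun j => Finset.range (N j)).card * ((q : ℝ) ^ 2 / 3) := by
  set U := Fintype.piFinset fun j => Finset.range (N j)
  set d := ∑ j, e j ^ 2
  set l : (Fin n → ℕ) → ℝ := fun u => ∑ j, e j * ((u j : ℝ) - (N j - 1) / 2)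
  have h1 : ((U.filter fun u => R * √d < |l u|).card : ℝ) * (R ^ 2 * d) ≤ ∑ u ∈ U, l u ^ 2 := by
    rw [← nsmul_eq_mul]
    refine (Finset.card_nsmul_le_sum _ (fun u => l u ^ 2) _ fun u hu => ?_).trans
      (Finset.sum_le_sum_of_subset_of_nonneg (Finset.filter_subset _ _)
        fun u _ _ => sq_nonneg (l u))
    have h2 := (Finset.mem_filter.1 hu).2
    have h3 : (R * √d) ^ 2 ≤ |l u| ^ 2 := pow_le_pow_left₀ (by positivity) h2.le 2
    rwa [mul_pow, Real.sq_sqrt he.le, sq_abs] at h3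
  have h2 : ∑ u ∈ U, l u ^ 2 ≤ U.card * ((q : ℝ) ^ 2 / 3 * d) := by
    refine (sum_piFinset_range_sq N e).trans_le (mul_le_mul_of_nonneg_left ?_ (by positivity))
    rw [mul_comm _ d, Finset.sum_mul]
    refine Finset.sum_le_sum fun j _ => mul_le_mul_of_nonneg_left ?_ (sq_nonneg _)
    have h3 : (N j : ℝ) ≤ 2 * q := by exact_mod_cast hN j
    have h4 : (N j : ℝ) ^ 2 ≤ (2 * q) ^ 2 := pow_le_pow_left₀ (by positivity) h3 2
    linarith
  refine le_of_mul_le_mul_right ?_ he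
  linarith

theorem card_box {n : ℕ} (S : Finset (Fin n)) (q : ℕ) :
    (Fintype.piFinset fun j => Finset.range (if j ∈ S then 2 * q else q)).card
      = 2 ^ S.card * q ^ n := by
  have h : ∀ j, (if j ∈ S then 2 * q else q) = (if j ∈ S then 2 else 1) * q := fun j => by
    split_ifs <;> ring
  simp only [Fintype.card_piFinset, Finset.card_range, h, Finset.prod_mul_distrib,
    Finset.prod_ite_mem, Finset.univ_inter, Finset.prod_const, Finset.card_univ, Fintype.card_fin]

/-- Chebyshev's inequality for several linear forms over the grid points of a box. -/
theorem card_filter_forall_linearForm_ge {m n : ℕ} (hm : 2 ≤ m) (N : Fin n → ℕ) (q : ℕ)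
    (hq : 0 < q) (hN : ∀ j, N j ≤ 2 * q) (e : Matrix (Fin m) (Fin n) ℝ) (d : Fin m → ℝ)
    (hd : ∀ i, 0 < d i) (hed : ∀ i, ∑ j, e i j ^ 2 = d i) :
    (19 / 27 : ℝ) * (Fintype.piFinset fun j => Finset.range (N j)).card
      ≤ ((Fintype.piFinset fun j => Finset.range (N j)).filter fun u =>
          ∀ i, |∑ j, e i j * ((u j : ℝ) - (N j - 1) / 2)| ≤ 3 * m * q / 4 * √(d i)).card := by
  have hbad : ∀ i, (((Fintype.piFinset fun j => Finset.range (N j)).filter fun u =>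
      3 * m * q / 4 * √(d i) < |∑ j, e i j * ((u j : ℝ) - (N j - 1) / 2)|).card : ℝ)
      ≤ (Fintype.piFinset fun j => Finset.range (N j)).card * (16 / (27 * m ^ 2)) := by
    intro i
    have h := card_filter_linearForm_mul_le N q hN (e i) (by rw [hed]; exact hd i)
      (3 * m * q / 4) (by positivity)
    rw [hed] at h
    refine le_of_mul_le_mul_right (h.trans_eq ?_)
      (show (0 : ℝ) < (3 * m * q / 4) ^ 2 by positivity)
    generalize ((Fintype.piFinset fun j => Finset.range (N j)).card : ℝ) = k
    field_simp
    norm_num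
  generalize Fintype.piFinset (fun j => Finset.range (N j)) = U at *
  set R : ℝ := 3 * m * q / 4
  have hm2 : (2 : ℝ) ≤ m := by exact_mod_cast hm
  set l : Fin m → (Fin n → ℕ) → ℝ := fun i u => ∑ j, e i j * ((u j : ℝ) - (N j - 1) / 2)
  set good := U.filter fun u => ∀ i, |l i u| ≤ R * √(d i)
  have hcover : U ⊆ good ∪ Finset.univ.biUnion fun i => U.filter fun u => R * √(d i) < |l i u| := by
    intro u hu
    by_cases h : ∀ i, |l i u| ≤ R * √(d i)
    · exact Finset.mem_union_left _ (Finset.mem_filter.2 ⟨hu, h⟩)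
    · push Not at h
      obtain ⟨i, hi⟩ := h
      exact Finset.mem_union_right _
        (Finset.mem_biUnion.2 ⟨i, Finset.mem_univ i, Finset.mem_filter.2 ⟨hu, hi⟩⟩)
  have h1 : (U.card : ℝ) ≤ good.card
      + ∑ i, ((U.filter fun u => R * √(d i) < |l i u|).card : ℝ) := by
    exact_mod_cast (Finset.card_le_card hcover).trans
      ((Finset.card_union_le _ _).trans (Nat.add_le_add_left Finset.card_biUnion_le _))
  have h2 := Finset.sum_le_sum fun i (_ : i ∈ Finset.univ) => hbad i
  rw [Finset.sum_const, Finset.card_univ, Fintype.card_fin, nsmul_eq_mul] at h2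
  -- The union bound loses a fraction 16/(27m) of the box, at most 8/27 since m ≥ 2.
  have h3 : (m : ℝ) * (U.card * (16 / (27 * m ^ 2))) ≤ U.card * (8 / 27) := by
    rw [mul_left_comm]
    refine mul_le_mul_of_nonneg_left ?_ (by positivity)
    rw [mul_div_assoc', div_le_div_iff₀ (by positivity) (by norm_num)]
    nlinarith
  linarith

/-! ### Comparing the counts -/

theorem card_image_mulVec_le {m n : ℕ} (A : Matrix (Fin m) (Fin n) ℤ)
    (L : Matrix (Fin m) (Fin m) ℝ) (hL : ∀ i j, i < j → L i j = 0) (hL1 : ∀ i, L i i = 1)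
    (c : Fin n → ℝ) (r : Fin m → ℝ) (hr : ∀ i, 0 ≤ r i) (V : Finset (Fin n → ℕ))
    (hV : ∀ u ∈ V, ∀ i,
      |∑ j, (L * A.map (Int.cast : ℤ → ℝ)) i j * ((u j : ℝ) - c j)| ≤ r i) :
    ((V.image fun u => A.mulVec fun j => (u j : ℤ)).card : ℝ) ≤ ∏ i, (2 * r i + 3) := by
  refine card_le_of_lowerTriangular L hL hL1
    (fun i => ∑ j, (L * A.map (Int.cast : ℤ → ℝ)) i j * c j) r hr _ ?_
  intro y hy i
  obtain ⟨u, hu, rfl⟩ := Finset.mem_image.1 hy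
  have h1 := hV u hu i
  have h2 : (fun k => ((A.mulVec (fun j => (u j : ℤ)) k : ℤ) : ℝ))
      = (A.map (Int.cast : ℤ → ℝ)).mulVec fun j => (u j : ℝ) := by
    funext k
    simp [Matrix.mulVec, dotProduct]
  rw [h2, Matrix.mulVec_mulVec]
  simpa only [Matrix.mulVec, dotProduct, mul_sub, Finset.sum_sub_distrib] using h1

/-- At least 19/27 of the box is good, and its size is at most the fibre bound times the number of
images. Dividing by q^n leaves the error 3/q in each factor. -/
theorem two_pow_card_le_prod {m n : ℕ} (hm : 2 ≤ m) (A : Matrix (Fin m) (Fin n) ℤ)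
    (S : Finset (Fin n))
    (hS : ∀ z : Fin n → ℤ, (∀ j, |z j| ≤ 1) → (∀ j, j ∉ S → z j = 0) → A.mulVec z = 0 → z = 0)
    (q : ℕ) (hq : q.Prime) (hdet : ¬ (q : ℤ) ∣ (A * A.transpose).det)
    (L : Matrix (Fin m) (Fin m) ℝ) (hL : ∀ i j, i < j → L i j = 0) (hL1 : ∀ i, L i i = 1)
    (d : Fin m → ℝ) (hd : ∀ i, 0 < d i)
    (hLd : ∀ i, ∑ j, (L * A.map (Int.cast : ℤ → ℝ)) i j ^ 2 = d i) :
    19 / 27 * (2 : ℝ) ^ S.card ≤ ∏ i, (3 * m / 2 * √(d i) + 3 * (q : ℝ)⁻¹) := by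
  obtain ⟨N, hN, hUc, hfiber⟩ : ∃ N : Fin n → ℕ, (∀ j, N j ≤ 2 * q) ∧
      ((Fintype.piFinset fun j => Finset.range (N j)).card : ℝ) = 2 ^ S.card * q ^ n ∧
      ∀ y, ((Fintype.piFinset fun j => Finset.range (N j)).filter
        (fun u : Fin n → ℕ => A.mulVec (fun j => (u j : ℤ)) = y)).card * q ^ m ≤ q ^ n :=
    ⟨fun j => if j ∈ S then 2 * q else q, fun j => by dsimp only; split_ifs <;> omega,
      by exact_mod_cast card_box S q, card_fiber_box_mul_le A S hS q hq hdet⟩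
  have hq0 : (0 : ℝ) < q := by exact_mod_cast hq.pos
  obtain ⟨good, hsub, hgood, hgood_ge⟩ : ∃ good : Finset (Fin n → ℕ),
      good ⊆ Fintype.piFinset (fun j => Finset.range (N j)) ∧
      (∀ u ∈ good, ∀ i, |∑ j, (L * A.map (Int.cast : ℤ → ℝ)) i j * ((u j : ℝ) - (N j - 1) / 2)|
        ≤ 3 * m * q / 4 * √(d i)) ∧
      (19 / 27 : ℝ) * (Fintype.piFinset fun j => Finset.range (N j)).card ≤ good.card :=
    ⟨_, Finset.filter_subset _ _, fun u hu => (Finset.mem_filter.1 hu).2,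
      card_filter_forall_linearForm_ge hm N q hq.pos hN _ d hd hLd⟩
  have himg := card_image_mulVec_le A L hL hL1 (fun j => ((N j : ℝ) - 1) / 2)
    (fun i => 3 * m * q / 4 * √(d i)) (fun i => by positivity) good hgood
  rw [hUc] at hgood_ge
  set I := good.image fun u => A.mulVec fun j => (u j : ℤ)
  have hfib : good.card * q ^ m ≤ q ^ n * I.card := by
    have h1 : good.card ≤ q ^ n / q ^ m * I.card := by
      refine Finset.card_le_mul_card_image _ _ fun y _ => ?_
      rw [Nat.le_div_iff_mul_le (pow_pos hq.pos m)]
      exact (Nat.mul_le_mul_right _ (Finset.card_le_card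
        (Finset.filter_subset_filter _ hsub))).trans (hfiber y)
    calc good.card * q ^ m ≤ q ^ n / q ^ m * I.card * q ^ m := Nat.mul_le_mul_right _ h1
      _ = q ^ n / q ^ m * q ^ m * I.card := by ring
      _ ≤ _ := Nat.mul_le_mul_right _ (Nat.div_mul_le_self _ _)
  have hfib' : (good.card : ℝ) * q ^ m ≤ q ^ n * I.card := by exact_mod_cast hfib
  have hprod : ∏ i, (2 * (3 * m * q / 4 * √(d i)) + 3)
      = q ^ m * ∏ i, (3 * m / 2 * √(d i) + 3 * (q : ℝ)⁻¹) := by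
    have : (q : ℝ) ^ m = ∏ _i : Fin m, (q : ℝ) := by simp
    rw [this, ← Finset.prod_mul_distrib]
    refine Finset.prod_congr rfl fun i _ => ?_
    field_simp
    ring
  rw [hprod] at himg
  refine le_of_mul_le_mul_left ?_ (show (0 : ℝ) < q ^ n * q ^ m by positivity)
  calc (q : ℝ) ^ n * q ^ m * (19 / 27 * 2 ^ S.card)
      = 19 / 27 * (2 ^ S.card * q ^ n) * q ^ m := by ring
    _ ≤ good.card * q ^ m := mul_le_mul_of_nonneg_right hgood_ge (by positivity)
    _ ≤ q ^ n * I.card := hfib'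
    _ ≤ q ^ n * (q ^ m * ∏ i, (3 * m / 2 * √(d i) + 3 * (q : ℝ)⁻¹)) :=
        mul_le_mul_of_nonneg_left himg (by positivity)
    _ = _ := by ring

open Filter Topology in
theorem two_pow_card_le_of_two_le {m n : ℕ} (hm : 2 ≤ m) (A : Matrix (Fin m) (Fin n) ℤ)
    (hA : LinearIndependent ℝ (A.map (Int.cast : ℤ → ℝ)).row) (S : Finset (Fin n))
    (hS : ∀ z : Fin n → ℤ, (∀ j, |z j| ≤ 1) → (∀ j, j ∉ S → z j = 0) → A.mulVec z = 0 → z = 0) :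
    (2 : ℝ) ^ S.card ≤ (2 * m) ^ m * √(((A * A.transpose).det : ℤ) : ℝ) := by
  set B := A.map (Int.cast : ℤ → ℝ) with hB
  have hpos := Matrix.posDef_mul_transpose_of_linearIndependent_row hA
  have hdet : (B * B.transpose).det = (((A * A.transpose).det : ℤ) : ℝ) := by
    have h1 : B * B.transpose = (Int.castRingHom ℝ).mapMatrix (A * A.transpose) := by
      ext i j
      simp [hB, Matrix.mul_apply]
    rw [h1, ← RingHom.map_det, eq_intCast]
  obtain ⟨L, d, hL, hL1, hconj, hprod⟩ := hpos.exists_lowerTriangular_conj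
  have hLd : ∀ i, ∑ j, (L * B) i j ^ 2 = d i := by
    intro i
    have h1 : (L * B) * (L * B).transpose = Matrix.diagonal d := by
      rw [← hconj, Matrix.transpose_mul]
      simp only [Matrix.mul_assoc]
    have h2 := congrFun (congrFun h1 i) i
    rw [Matrix.diagonal_apply_eq, Matrix.mul_apply] at h2
    simpa only [Matrix.transpose_apply, ← sq] using h2
  have hd : ∀ i, 0 < d i := by
    intro i
    refine lt_of_le_of_ne (by rw [← hLd]; positivity) (Ne.symm ?_)
    exact Finset.prod_ne_zero_iff.1 (hprod.trans_ne hpos.det_pos.ne') i (Finset.mem_univ i)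
  have hdetZ : (A * A.transpose).det ≠ 0 := by
    intro h
    have := hpos.det_pos
    rw [hdet, h] at this
    simp at this
  have hlim : Tendsto (fun q : ℕ => ∏ i, (3 * m / 2 * √(d i) + 3 * (q : ℝ)⁻¹)) atTop
      (𝓝 (∏ i, (3 * m / 2 * √(d i) + 3 * 0))) :=
    tendsto_finsetProd _ fun i _ =>
      tendsto_const_nhds.add (tendsto_const_nhds.mul tendsto_inv_atTop_nhds_zero_nat)
  have hfreq : ∃ᶠ q : ℕ in atTop,
      19 / 27 * (2 : ℝ) ^ S.card ≤ ∏ i, (3 * m / 2 * √(d i) + 3 * (q : ℝ)⁻¹) := by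
    refine frequently_atTop.2 fun a => ?_
    obtain ⟨q, hqa, hq⟩ := Nat.exists_infinite_primes (max a ((A * A.transpose).det.natAbs + 1))
    refine ⟨q, (le_max_left _ _).trans hqa,
      two_pow_card_le_prod hm A S hS q hq (fun h => ?_) L hL hL1 d hd hLd⟩
    have h1 := Nat.le_of_dvd (Int.natAbs_pos.2 hdetZ) (Int.natCast_dvd.1 h)
    have h2 := (le_max_right _ _).trans hqa
    omega
  have hkey := ge_of_tendsto_of_frequently hlim hfreq
  have hlimval : ∏ i, (3 * m / 2 * √(d i) + 3 * 0)
      = (3 / 4 : ℝ) ^ m * ((2 * m) ^ m * √(((A * A.transpose).det : ℤ) : ℝ)) := by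
    have h1 : √(((A * A.transpose).det : ℤ) : ℝ) = ∏ i, √(d i) := by
      rw [← hdet, ← hprod, Real.sqrt_prod _ fun i _ => (hd i).le]
    simp only [mul_zero, add_zero]
    rw [h1, Finset.prod_mul_distrib, Finset.prod_const, Finset.card_univ, Fintype.card_fin,
      ← mul_assoc, ← mul_pow]
    congr 2
    ring
  rw [hlimval] at hkey
  -- The limit is (3/4)^m times the target, and (3/4)² = 9/16 is less than 19/27.
  have h34 : (3 / 4 : ℝ) ^ m ≤ (3 / 4) ^ 2 := pow_le_pow_of_le_one (by norm_num) (by norm_num) hm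
  have h0 : (0 : ℝ) ≤ (2 * m) ^ m * √(((A * A.transpose).det : ℤ) : ℝ) := by positivity
  nlinarith [mul_le_mul_of_nonneg_right h34 h0]

/-- The box with q = 1 consists of the indicator vectors of subsets of S, on which A is injective.
Comparing the least variance of 2^|S| distinct integers with the actual one gives 4^|S| - 1 ≤ 3
det(AAᵀ), and det(AAᵀ) ≥ 1 absorbs the 1. -/
theorem two_pow_card_le_of_eq_one {n : ℕ} (A : Matrix (Fin 1) (Fin n) ℤ)
    (hA : LinearIndependent ℝ (A.map (Int.cast : ℤ → ℝ)).row) (S : Finset (Fin n))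
    (hS : ∀ z : Fin n → ℤ, (∀ j, |z j| ≤ 1) → (∀ j, j ∉ S → z j = 0) → A.mulVec z = 0 → z = 0) :
    (2 : ℝ) ^ S.card ≤ 2 * √(((A * A.transpose).det : ℤ) : ℝ) := by
  set N : Fin n → ℕ := fun j => if j ∈ S then 2 * 1 else 1 with hN
  set U := Fintype.piFinset fun j => Finset.range (N j) with hU
  have hUc : U.card = 2 ^ S.card := by
    exact (card_box S 1).trans (by rw [one_pow, mul_one])
  have hdet : (A * A.transpose).det = ∑ j, A 0 j ^ 2 := by
    simp [Matrix.mul_apply, sq]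
  have hpos : 1 ≤ ∑ j, A 0 j ^ 2 := by
    by_contra h
    have h0 : ∑ j, A 0 j ^ 2 = 0 :=
      le_antisymm (by omega) (Finset.sum_nonneg fun j _ => sq_nonneg _)
    rw [Finset.sum_eq_zero_iff_of_nonneg fun j _ => sq_nonneg _] at h0
    refine hA.ne_zero 0 (funext fun j => ?_)
    simpa using h0 j (Finset.mem_univ j)
  set f : (Fin n → ℕ) → ℤ := fun u => ∑ j, A 0 j * u j with hf
  have hinj : Set.InjOn f U := by
    intro u hu w hw huw
    simp only [hU, Finset.mem_coe, Fintype.mem_piFinset, Finset.mem_range, hN] at hu hw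
    have h := hS (fun j => (u j : ℤ) - w j) (fun j => ?_) (fun j hj => ?_) ?_
    · funext j
      have := congrFun h j
      simp only [Pi.zero_apply] at this
      omega
    · have h1 := hu j
      have h2 := hw j
      rw [abs_le]
      split_ifs at h1 h2 <;> omega
    · have h1 := hu j
      have h2 := hw j
      rw [if_neg hj] at h1 h2
      omega
    · funext i
      rw [Subsingleton.elim i 0]
      simp only [hf] at huw
      simp [Matrix.mulVec, dotProduct, mul_sub, huw]
  have hY := Finset.le_sum_sub_sq (U.image f) (∑ j, (A 0 j : ℝ) * ((N j - 1) / 2))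
  rw [Finset.sum_image hinj, Finset.card_image_of_injOn hinj] at hY
  have hsum := sum_piFinset_range_sq N fun j => (A 0 j : ℝ)
  have hle : ∑ j, (A 0 j : ℝ) ^ 2 * (((N j : ℝ) ^ 2 - 1) / 12) ≤ (∑ j, (A 0 j : ℝ) ^ 2) / 4 := by
    rw [Finset.sum_div]
    refine Finset.sum_le_sum fun j _ => ?_
    simp only [hN]
    split_ifs
    · norm_num; linarith
    · norm_num; positivity
  have heq : ∑ u ∈ U, ((f u : ℝ) - ∑ j, (A 0 j : ℝ) * ((N j - 1) / 2)) ^ 2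
      = ∑ u ∈ U, (∑ j, (A 0 j : ℝ) * ((u j : ℝ) - (N j - 1) / 2)) ^ 2 := by
    simp [hf, mul_sub, Finset.sum_sub_distrib]
  rw [heq, hsum] at hY
  have hUpos : (0 : ℝ) < U.card := by rw [hUc]; positivity
  have h1 : ((U.card : ℝ) ^ 2 - 1) / 12 ≤ (∑ j, (A 0 j : ℝ) ^ 2) / 4 := by
    refine le_of_mul_le_mul_left ?_ hUpos
    rw [← mul_div_assoc]
    exact hY.trans (mul_le_mul_of_nonneg_left hle hUpos.le)
  have hpos' : (1 : ℝ) ≤ ∑ j, (A 0 j : ℝ) ^ 2 := by exact_mod_cast hpos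
  have hUc' : (U.card : ℝ) = 2 ^ S.card := by exact_mod_cast hUc
  rw [hdet, ← hUc', ← div_le_iff₀' (by norm_num)]
  refine Real.le_sqrt_of_sq_le ?_
  push_cast
  linarith

theorem two_pow_card_le {m n : ℕ} (A : Matrix (Fin m) (Fin n) ℤ)
    (hA : LinearIndependent ℝ (A.map (Int.cast : ℤ → ℝ)).row) (S : Finset (Fin n))
    (hS : ∀ z : Fin n → ℤ, (∀ j, |z j| ≤ 1) → (∀ j, j ∉ S → z j = 0) → A.mulVec z = 0 → z = 0) :
    (2 : ℝ) ^ S.card ≤ (2 * m) ^ m * √(((A * A.transpose).det : ℤ) : ℝ) := by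
  rcases m with _ | _ | m
  -- With no rows every vector is in the kernel, so a unit vector on S would violate `hS`.
  · have hempty : S = ∅ := by
      by_contra hne
      obtain ⟨j, hj⟩ := Finset.nonempty_iff_ne_empty.2 hne
      have h := hS (Pi.single j 1) (fun k => ?_) (fun k hk => ?_) (Subsingleton.elim _ _)
      · simpa using congrFun h j
      · by_cases h : k = j <;> simp [h]
      · exact Pi.single_eq_of_ne (fun h => hk (by rwa [h])) 1
    simp [hempty]
  · simpa using two_pow_card_le_of_eq_one A hA S hS
  · exact two_pow_card_le_of_two_le (by omega) A hA S hS

theorem mainTheorem11 {m n : ℕ} (A : Matrix (Fin m) (Fin n) ℤ) (b : Fin m → ℤ)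
    (hA : LinearIndependent ℝ (A.map (Int.cast : ℤ → ℝ)).row)
    (v : Fin n → ℝ) (hv : IsVertexOf v (integerHull A b)) :
    ((supp v).card : ℝ) ≤
      (m : ℝ) + (m : ℝ) * Real.logb 2 (m : ℝ) +
        Real.logb 2 (Real.sqrt (((A * A.transpose).det : ℤ) : ℝ)) := by
  have h := two_pow_card_le A hA (supp v) (eq_zero_of_isVertexOf_integerHull hv)
  have hpos : (0 : ℝ) < 2 ^ (supp v).card := by positivity
  have hne := (hpos.trans_le h).ne'
  have hlog := Real.logb_le_logb_of_le (b := 2) (by norm_num) hpos h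
  rw [Real.logb_mul (left_ne_zero_of_mul hne) (right_ne_zero_of_mul hne), Real.logb_pow,
    Real.logb_pow, Real.logb_self_eq_one (by norm_num), mul_one] at hlog
  rcases Nat.eq_zero_or_pos m with rfl | hm
  · simpa using hlog
  · rw [Real.logb_mul (by norm_num) (by positivity), Real.logb_self_eq_one (by norm_num),
      mul_add, mul_one] at hlog
    exact hlog
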